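/- Let $f^{\{1\}},\dots,f^{\{N\}}$ be $C^\infty$ vector fields on $\mathbb{R}^d$. For $v\subseteq\{1,\dots,N\}$ put $f^{v}=\sum_{m\in v}f^{\{m\}}$, and let $\varphi^{v}_t$ denote the exact (local) $t$-flow of $x'=f^{v}(x)$, for positive and negative $t$. **Order.** Let $g$ be a smooth vector field on $\mathbb{R}^d$ with Lie derivative $D_g=\langle g,\nabla\rangle$. A one-step method $\Phi_h:\mathbb{R}^d\to\mathbb{R}^d$ has order (at least) $q\in\mathbb{N}_0$ for $x'=g(x)$ if there is a smooth vector field $E$ such that $$\Phi_h=\exp\bigl(hD_g+h^{q+1}D_E+\mathcal O(h^{q+2})\bigr)\,\mathrm{Id}\qquad(h\to0),$$ that is, if $$\Phi_h(x)=\sum_{k=0}^{q+1}\frac1{k!}\Bigl(\bigl(hD_g+h^{q+1}D_E\bigr)^k\,\mathrm{Id}\Bigr)(x)+\mathcal O(h^{q+2})$$ as $h\to0$, for $h$ of either sign and locally uniformly in $x$. **Splitting tree.** A splitting tree for $N$ partitions is a full ordered binary tree whose nodes are nonempty subsets of $\{1,\dots,N\}$, whose root is $r=\{1,\dots,N\}$,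 in which every inner node is the disjoint union of its left and its right child, and whose leaves are singletons. **Hierarchical splitting method.** Such a method is given by a splitting tree, by real coefficients $a^{i}_1,b^{i}_1,\dots,a^{i}_{s^i},b^{i}_{s^i}$ for every inner node $i$, by a set $L'$ of leaves, and by a one-step method $\Phi^{\ell}_h$ for every leaf $\ell\in L'$. A step $\Psi^{v}_h$ at a node $v$ is defined recursively: * $\Psi^{\ell}_h=\Phi^{\ell}_h$ for leaves $\ell\in L'$; * $\Psi^{\ell}_h=\varphi^{\ell}_h$ for leaves $\ell\notin L'$; * for an inner node $i$ with left child $v$ and right child $w$, $$\Psi^{i}_h=\Psi^{w}_{b^i_{s^i}h}\circ\Psi^{v}_{a^i_{s^i}h}\circ\dots\circ\Psi^{w}_{b^i_1h}\circ\Psi^{v}_{a^i_1h}.$$ The hierarchical splitting method is $\Phi_h=\Psi^{r}_h$. The splitting method assigned to the inner node $i$ is the same composition with the exact flows of the children, $$\Phi^{i}_h=\varphi^{w}_{b^i_{s^i}h}\circ\varphi^{v}_{a^i_{s^i}h}\circ\dots\circ\varphi^{w}_{b^i_1h}\circ\varphi^{v}_{a^i_1h}.$$ **Statement.** Let $p\in\mathbb{N}_0$.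 Suppose that for every node $v$ that is an inner node or belongs to $L'$ the assigned method $\Phi^{v}_h$ has some order $p^{v}\ge p$ for $x'=f^{v}(x)$. Then the hierarchical splitting method $\Phi_h$ has order (at least) $p$ for $x'=f(x)$, $f=\sum_{m=1}^{N}f^{\{m\}}$. -/

import Mathlib

open scoped ContDiff Topology

namespace HierSplit

noncomputable section

/-- Full ordered binary trees whose leaves carry one of the indices of the `N` partitions. -/
inductive BinTree (N : ℕ) : Type
  | leaf (m : Fin N) : BinTree N
  | node (l r : BinTree N) : BinTree N

/-- The set of partition indices that a (sub)tree stands for: the subset of the `N` indices that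
its root, as a node of a splitting tree, *is*. -/
def BinTree.label {N : ℕ} : BinTree N → Finset (Fin N)
  | .leaf m => {m}
  | .node l r => l.label ∪ r.label

/-- All nodes of a tree, each one represented by the subtree hanging from it. -/
def BinTree.nodes {N : ℕ} : BinTree N → Set (BinTree N)
  | .leaf m => {.leaf m}
  | .node l r => insert (.node l r) (l.nodes ∪ r.nodes)

/-- Splitting trees for `N` partitions: the root is the set of all indices, each inner node is the
disjoint union of its two children, and the leaves are singletons. Hence distinct nodes of the tree
have distinct labels, so that a node may be identified with its label. -/
structure SplittingTree (N : ℕ) where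
  tree : BinTree N
  root_label : tree.label = Finset.univ
  disjoint_children : ∀ l r : BinTree N, BinTree.node l r ∈ tree.nodes → Disjoint l.label r.label

section Dynamics

variable {X : Type*} [NormedAddCommGroup X] [NormedSpace ℝ X]

open Classical in
/-- The exact `t`-flow of `x' = f x`: the value at time `t` (positive or negative) of the solution
that starts at `x`. Where that solution does not exist up to time `t`, the value is `x`. -/
def exactFlow (f : X → X) (t : ℝ) (x : X) : X :=
  if h : ∃ γ : ℝ → X, γ 0 = x ∧ IsIntegralCurveOn γ (fun _ => f) (Set.uIcc 0 t) then
    h.choose t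
  else x

/-- The Lie derivative `⟨f, ∇⟩ g` along the vector field `f`. -/
def lieDerivative (f : X → X) (g : X → X) : X → X := fun x => fderiv ℝ g x (f x)

/-- The Lie series `exp(D) Id`, `D = ⟨f, ∇⟩`, cut off after the term with `D ^ n / n!`. -/
def lieExp (n : ℕ) (f : X → X) (x : X) : X :=
  ∑ k ∈ Finset.range (n + 1), ((k.factorial : ℝ)⁻¹) • ((lieDerivative f)^[k] id) x

/-- `Φ` is a one-step method of order (at least) `p` for `x' = f x`:
`Φ_h = exp(h D + h ^ (p + 1) O_{p+1} + O(h ^ (p + 2))) Id` as `h → 0`, where `D = ⟨f, ∇⟩` and the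
leading error term `O_{p+1} = ⟨E, ∇⟩` is the first-order differential operator of a smooth vector
field `E`. The terms of the Lie series beyond the `(p + 1)`-st, and a remainder `O(h ^ (p + 2))` in
the exponent, only contribute `O(h ^ (p + 2))`. The estimate is locally uniform in the state, and
`h` may have either sign, as the fractions of a step in a splitting method may be negative. -/
def HasOrder (f : X → X) (Φ : ℝ → X → X) (p : ℕ) : Prop :=
  ∃ E : X → X, ContDiff ℝ ∞ E ∧ ∀ x₀ : X,
    (fun z : ℝ × X =>
      Φ z.1 z.2 - lieExp (p + 1) (fun y => z.1 • f y + z.1 ^ (p + 1) • E y) z.2)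
      =O[𝓝 ((0 : ℝ), x₀)] (fun z : ℝ × X => z.1 ^ (p + 2))

/-- The splitting scheme for two partitions with the coefficients `(a₁, b₁), …, (a_s, b_s)`,
`φ^w_{b_s h} ∘ φ^v_{a_s h} ∘ ⋯ ∘ φ^w_{b₁ h} ∘ φ^v_{a₁ h}`. -/
def twoSplit : List (ℝ × ℝ) → (ℝ → X → X) → (ℝ → X → X) → ℝ → X → X
  | [], _, _, _, x => x
  | (a, b) :: cs, φv, φw, h, x => twoSplit cs φv φw h (φw (b * h) (φv (a * h) x))

/-- The vector field `f^v = ∑_{m ∈ v} f^m` of a set `v` of partitions. -/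
def partialField {N : ℕ} (f : Fin N → X → X) (v : Finset (Fin N)) : X → X :=
  fun x => ∑ m ∈ v, f m x

end Dynamics

/-- The data of a hierarchical splitting method: a splitting tree, the coefficients `(a_j, b_j)` of
a splitting method for two partitions for each inner node, the set of those `m` for which the flow
at the leaf `{m}` is computed by a numerical integration scheme, and these schemes. (Values of
`coeff` off the inner nodes and of `scheme` off `numericLeaves` play no role.) -/
structure HierarchicalSplittingMethod (N : ℕ) (X : Type*) extends SplittingTree N where
  coeff : Finset (Fin N) → List (ℝ × ℝ)
  numericLeaves : Set (Fin N)
  scheme : Fin N → ℝ → X → X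

namespace HierarchicalSplittingMethod

variable {N : ℕ} {X : Type*} [NormedAddCommGroup X] [NormedSpace ℝ X]

open Classical in
/-- A step of the method at a node: at an inner node, the two-partition splitting scheme, with the
flows of the children replaced by the steps at the children; at a leaf, the numerical scheme or the
exact flow. -/
def step (M : HierarchicalSplittingMethod N X) (f : Fin N → X → X) : BinTree N → ℝ → X → X
  | .leaf m => if m ∈ M.numericLeaves then M.scheme m else exactFlow (f m)
  | .node l r => twoSplit (M.coeff (BinTree.node l r).label) (M.step f l) (M.step f r)

/-- The splitting method assigned to the inner node with children `l` and `r`, with the exact flows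
of the two vector fields that belong to the children. -/
def innerMethod (M : HierarchicalSplittingMethod N X) (f : Fin N → X → X) (l r : BinTree N) :
    ℝ → X → X :=
  twoSplit (M.coeff (BinTree.node l r).label)
    (exactFlow (partialField f l.label)) (exactFlow (partialField f r.label))

/-- One step of the hierarchical splitting method: a step at the root. -/
def method (M : HierarchicalSplittingMethod N X) (f : Fin N → X → X) : ℝ → X → X :=
  M.step f M.tree

end HierarchicalSplittingMethod

end

end HierSplit

namespace HierSplit

open Filter Asymptotics Set

variable {X : Type*} [NormedAddCommGroup X] [NormedSpace ℝ X]

/-! Exact flows and Lie exponentials are compared with one reference, the Taylor polynomial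
`flowTaylor f (p + 1)`, which is defined everywhere and smooth. Order `p` means differing from it by
`h ^ (p + 1) • E + O(h ^ (p + 2))` with smooth `E` (`hasOrder_iff`), and the exact flow differs from
it by `O(h ^ (p + 2))` (`isPerturbation_exactFlow`). Such perturbations can be inverted, chained
and, around near-identity maps, composed: to leading order the errors of the factors just add
(`IsPerturbation.comp`, `IsPerturbation.twoSplit`). Induction over the tree then links, at an inner
node, the Taylor map of the node, its assigned method, the same composition of the children's Taylor
maps, and the actual step. -/

/-- The one-step map `Φ'` is `Φ + h ^ (p + 1) E + O(h ^ (p + 2))`, locally uniformly. -/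
def IsPerturbation (p : ℕ) (Φ Φ' : ℝ → X → X) (E : X → X) : Prop :=
  ∀ x₀ : X, (fun z : ℝ × X => Φ' z.1 z.2 - Φ z.1 z.2 - z.1 ^ (p + 1) • E z.2)
    =O[𝓝 ((0 : ℝ), x₀)] (fun z : ℝ × X => z.1 ^ (p + 2))

/-- `Φ_h` is the identity up to a map of size `O(h)` with Lipschitz constant `O(h)`, locally
uniformly. -/
structure IsNearIdentity (Φ : ℝ → X → X) : Prop where
  sub_id : ∀ x₀ : X, (fun z : ℝ × X => Φ z.1 z.2 - z.2) =O[𝓝 ((0 : ℝ), x₀)] Prod.fst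
  lipschitz : ∀ x₀ : X, (fun z : ℝ × X × X => (Φ z.1 z.2.1 - z.2.1) - (Φ z.1 z.2.2 - z.2.2))
    =O[𝓝 ((0 : ℝ), x₀, x₀)] (fun z : ℝ × X × X => z.1 • (z.2.1 - z.2.2))

/-! ### Local asymptotics and near-identity maps. -/

theorem isBigO_const_mul_fst_pow (a : ℝ) (n : ℕ) {Y : Type*} (l : Filter (ℝ × Y)) :
    (fun z : ℝ × Y => (a * z.1) ^ n) =O[l] (fun z : ℝ × Y => z.1 ^ n) := by
  simp_rw [mul_pow]
  exact (isBigO_refl _ _).const_mul_left _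

theorem ContinuousAt.isBigO_fst_pow_smul {Y : Type*} [TopologicalSpace Y] {c : ℝ × Y → X} {y : Y}
    (hc : ContinuousAt c (0, y)) (n : ℕ) :
    (fun z : ℝ × Y => z.1 ^ n • c z) =O[𝓝 ((0 : ℝ), y)] (fun z : ℝ × Y => z.1 ^ n) := by
  simpa using (isBigO_refl (fun z : ℝ × Y => z.1 ^ n) (𝓝 ((0 : ℝ), y))).smul (hc.isBigO_one ℝ)

theorem isBigO_fst_pow_of_le {Y : Type*} [TopologicalSpace Y] {m n : ℕ} (hmn : m ≤ n) (y : Y) :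
    (fun z : ℝ × Y => z.1 ^ n) =O[𝓝 ((0 : ℝ), y)] (fun z : ℝ × Y => z.1 ^ m) :=
  (ContinuousAt.isBigO_fst_pow_smul (c := fun z : ℝ × Y => z.1 ^ (n - m)) (by fun_prop) m).congr_left
    fun z => by simp [← pow_add, hmn]

theorem tendsto_of_isBigO_sub_snd {X : Type*} [NormedAddCommGroup X] {Φ : ℝ → X → X} {x₀ : X}
    (h : (fun z : ℝ × X => Φ z.1 z.2 - z.2) =O[𝓝 ((0 : ℝ), x₀)] Prod.fst) (a : ℝ) :
    Tendsto (fun z : ℝ × X => Φ (a * z.1) z.2) (𝓝 (0, x₀)) (𝓝 x₀) := by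
  have h0 : Tendsto (fun z : ℝ × X => Φ z.1 z.2 - z.2) (𝓝 (0, x₀)) (𝓝 0) :=
    h.trans_tendsto (continuous_fst.tendsto' _ _ rfl)
  have h1 : Tendsto (fun z : ℝ × X => (a * z.1, z.2)) (𝓝 (0, x₀)) (𝓝 (0, x₀)) :=
    Continuous.tendsto' (by fun_prop) _ _ (by simp)
  have h2 := (h0.comp h1).add (continuous_snd.tendsto ((0 : ℝ), x₀))
  simpa [Function.comp_def] using h2

theorem tendsto_scale {X : Type*} [TopologicalSpace X] (a : ℝ) (x₀ : X) :
    Tendsto (fun z : ℝ × X => (a * z.1, z.2)) (𝓝 (0, x₀)) (𝓝 (0, x₀)) :=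
  Continuous.tendsto' (by fun_prop) _ _ (by simp)

namespace IsNearIdentity

theorem comp {Φ Ψ : ℝ → X → X} (hΦ : IsNearIdentity Φ) (hΨ : IsNearIdentity Ψ) (a b : ℝ) :
    IsNearIdentity (fun h x => Ψ (b * h) (Φ (a * h) x)) where
  sub_id x₀ := by
    have h1 := (hΦ.sub_id x₀).comp_tendsto (tendsto_scale a x₀)
    have h2 := (hΨ.sub_id x₀).comp_tendsto (k := fun z : ℝ × X => (b * z.1, Φ (a * z.1) z.2))
      (l' := 𝓝 (0, x₀)) (Tendsto.prodMk_nhds (Continuous.tendsto' (by fun_prop) _ _ (by simp))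
        (tendsto_of_isBigO_sub_snd (hΦ.sub_id x₀) a))
    have h1' := h1.trans (isBigO_const_mul_self a Prod.fst (𝓝 ((0 : ℝ), x₀)))
    have h2' := h2.trans (isBigO_const_mul_self b Prod.fst (𝓝 ((0 : ℝ), x₀)))
    refine (h2'.add h1').congr_left fun z => ?_
    simp
  lipschitz x₀ := by
    have t1 : Tendsto (fun z : ℝ × X × X => (a * z.1, z.2)) (𝓝 (0, x₀, x₀)) (𝓝 (0, x₀, x₀)) :=
      Continuous.tendsto' (by fun_prop) _ _ (by simp)
    have h1 := (hΦ.lipschitz x₀).comp_tendsto t1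
    have ta := tendsto_of_isBigO_sub_snd (hΦ.sub_id x₀) a
    have t2 : Tendsto (fun z : ℝ × X × X => (b * z.1, Φ (a * z.1) z.2.1, Φ (a * z.1) z.2.2))
        (𝓝 (0, x₀, x₀)) (𝓝 (0, x₀, x₀)) :=
      Tendsto.prodMk_nhds (Continuous.tendsto' (by fun_prop) _ _ (by simp))
        (Tendsto.prodMk_nhds
          (ta.comp (Continuous.tendsto' (f := fun z : ℝ × X × X => (z.1, z.2.1))
            (by fun_prop) (0, x₀, x₀) _ rfl))
          (ta.comp (Continuous.tendsto' (f := fun z : ℝ × X × X => (z.1, z.2.2))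
            (by fun_prop) (0, x₀, x₀) _ rfl)))
    have h2 := (hΨ.lipschitz x₀).comp_tendsto t2
    have h1' : (fun z : ℝ × X × X => (Φ (a * z.1) z.2.1 - z.2.1) - (Φ (a * z.1) z.2.2 - z.2.2))
        =O[𝓝 ((0 : ℝ), x₀, x₀)] (fun z : ℝ × X × X => z.1 • (z.2.1 - z.2.2)) := by
      refine h1.trans ?_
      simp only [Function.comp_def, mul_smul]
      exact (isBigO_refl _ _).const_smul_left _
    have hz : (fun z : ℝ × X × X => z.1 • (z.2.1 - z.2.2)) =O[𝓝 ((0 : ℝ), x₀, x₀)]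
        (fun z : ℝ × X × X => z.2.1 - z.2.2) := by
      have : (fun z : ℝ × X × X => z.1) =O[𝓝 ((0 : ℝ), x₀, x₀)] (fun _ => (1 : ℝ)) :=
        continuous_fst.continuousAt.isBigO_one ℝ
      simpa using this.smul (isBigO_refl (fun z : ℝ × X × X => z.2.1 - z.2.2) _)
    have h3 : (fun z : ℝ × X × X => Φ (a * z.1) z.2.1 - Φ (a * z.1) z.2.2)
        =O[𝓝 ((0 : ℝ), x₀, x₀)] (fun z : ℝ × X × X => z.2.1 - z.2.2) := by
      refine ((h1'.trans hz).add (isBigO_refl _ _)).congr_left fun z => ?_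
      abel
    have h2' : (fun z : ℝ × X × X =>
        (Ψ (b * z.1) (Φ (a * z.1) z.2.1) - Φ (a * z.1) z.2.1)
          - (Ψ (b * z.1) (Φ (a * z.1) z.2.2) - Φ (a * z.1) z.2.2))
        =O[𝓝 ((0 : ℝ), x₀, x₀)] (fun z : ℝ × X × X => z.1 • (z.2.1 - z.2.2)) := by
      refine h2.trans ?_
      simp only [Function.comp_def, mul_smul]
      exact ((isBigO_refl _ _).smul h3).const_smul_left _
    refine (h2'.add h1').congr_left fun z => ?_
    abel

theorem id : IsNearIdentity (fun (_ : ℝ) (x : X) => x) where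
  sub_id x₀ := by simpa using isBigO_zero _ _
  lipschitz x₀ := by simpa using isBigO_zero _ _

theorem twoSplit {Φ Ψ : ℝ → X → X} (hΦ : IsNearIdentity Φ) (hΨ : IsNearIdentity Ψ)
    (cs : List (ℝ × ℝ)) : IsNearIdentity (twoSplit cs Φ Ψ) := by
  induction cs with
  | nil => exact .id
  | cons c cs ih =>
    have h := (hΦ.comp hΨ c.1 c.2).comp ih 1 1
    simp only [one_mul] at h
    exact h

end IsNearIdentity

/-! ### Calculus of perturbations of one-step maps. -/

namespace IsPerturbation

variable {p : ℕ} {Φ Φ' Φ'' Ψ Ψ' : ℝ → X → X} {E F : X → X}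

theorem refl (p : ℕ) (Φ : ℝ → X → X) : IsPerturbation p Φ Φ 0 := fun x₀ => by
  simpa using isBigO_zero _ _

theorem symm (h : IsPerturbation p Φ Φ' E) : IsPerturbation p Φ' Φ (-E) := fun x₀ => by
  refine (h x₀).neg_left.congr_left fun z => ?_
  simp only [Pi.neg_apply, smul_neg]
  abel

theorem trans (h : IsPerturbation p Φ Φ' E) (h' : IsPerturbation p Φ' Φ'' F) :
    IsPerturbation p Φ Φ'' (E + F) := fun x₀ => by
  refine ((h x₀).add (h' x₀)).congr_left fun z => ?_
  simp only [Pi.add_apply, smul_add]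
  abel

theorem isBigO_sub (h : IsPerturbation p Φ Φ' E) (hE : Continuous E) (x₀ : X) :
    (fun z : ℝ × X => Φ' z.1 z.2 - Φ z.1 z.2) =O[𝓝 ((0 : ℝ), x₀)]
      (fun z : ℝ × X => z.1 ^ (p + 1)) := by
  have h1 := (h x₀).trans (isBigO_fst_pow_of_le (Nat.le_succ (p + 1)) x₀)
  have h2 := ContinuousAt.isBigO_fst_pow_smul (c := fun z : ℝ × X => E z.2) (y := x₀)
    (by fun_prop) (p + 1)
  refine (h1.add h2).congr_left fun z => ?_
  abel

/-- Passing through `Ψ` changes the inner error `O(h ^ (p + 1))` only by a factor `1 + O(h)`, and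
`F` may be evaluated at `x` instead of at the inner image, which is `O(h)` away. -/
theorem comp (hΦ : IsNearIdentity Φ) (hΨ : IsNearIdentity Ψ)
    (h : IsPerturbation p Φ Φ' E) (h' : IsPerturbation p Ψ Ψ' F)
    (hE : Continuous E) (hF : ContDiff ℝ 1 F) (a b : ℝ) :
    IsPerturbation p (fun h x => Ψ (b * h) (Φ (a * h) x)) (fun h x => Ψ' (b * h) (Φ' (a * h) x))
      (a ^ (p + 1) • E + b ^ (p + 1) • F) := fun x₀ => by
  have hle : (fun z : ℝ × X => z.1 ^ (p + 1)) =O[𝓝 ((0 : ℝ), x₀)] (fun z : ℝ × X => z.1) := by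
    simpa using isBigO_fst_pow_of_le (Nat.le_add_left 1 p) x₀
  have hΦ'id : (fun z : ℝ × X => Φ' z.1 z.2 - z.2) =O[𝓝 ((0 : ℝ), x₀)] Prod.fst := by
    refine (((h.isBigO_sub hE x₀).trans hle).add (hΦ.sub_id x₀)).congr_left fun z => ?_
    abel
  have tΦ := tendsto_of_isBigO_sub_snd (hΦ.sub_id x₀) a
  have tΦ' := tendsto_of_isBigO_sub_snd hΦ'id a
  have tb : Tendsto (fun z : ℝ × X => b * z.1) (𝓝 (0, x₀)) (𝓝 0) :=
    Continuous.tendsto' (by fun_prop) _ _ (by simp)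
  have e1 := ((h' x₀).comp_tendsto (tb.prodMk_nhds tΦ')).trans
    (isBigO_const_mul_fst_pow b (p + 2) _)
  have hd := ((h.isBigO_sub hE x₀).comp_tendsto (tendsto_scale a x₀)).trans
    (isBigO_const_mul_fst_pow a (p + 1) _)
  -- The Lipschitz constant `O(h)` of `Ψ - id` supplies the missing power of `h`.
  have e2 := ((hΨ.lipschitz x₀).comp_tendsto (tb.prodMk_nhds (tΦ'.prodMk_nhds tΦ))).trans
    (((isBigO_const_mul_self b Prod.fst (𝓝 ((0 : ℝ), x₀))).smul hd).congr_right
      (g₂ := fun z : ℝ × X => z.1 ^ (p + 2)) fun z => by simp [pow_succ' z.1 (p + 1)])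
  have e3 := ((h x₀).comp_tendsto (tendsto_scale a x₀)).trans (isBigO_const_mul_fst_pow a (p + 2) _)
  have hFsub := ((hF.contDiffAt.hasStrictFDerivAt (x := x₀) one_ne_zero).isBigO_sub).comp_tendsto
    (tΦ'.prodMk_nhds (continuous_snd.tendsto ((0 : ℝ), x₀)))
  have hid := (hΦ'id.comp_tendsto (tendsto_scale a x₀)).trans
    (isBigO_const_mul_self a Prod.fst (𝓝 ((0 : ℝ), x₀)))
  have e4 := ((isBigO_const_mul_fst_pow b (p + 1) (𝓝 ((0 : ℝ), x₀))).smul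
    (hFsub.trans hid)).congr_right (g₂ := fun z : ℝ × X => z.1 ^ (p + 2)) fun z => by
      simp [pow_succ z.1 (p + 1)]
  refine (((e1.add e2).add e3).add e4).congr_left fun z => ?_
  simp only [Function.comp_apply, Pi.add_apply, Pi.smul_apply, mul_pow, smul_add, smul_sub,
    smul_smul, mul_comm (z.1 ^ (p + 1))]
  abel

theorem twoSplit (hΦ : IsNearIdentity Φ) (hΨ : IsNearIdentity Ψ)
    (h : IsPerturbation p Φ Φ' E) (h' : IsPerturbation p Ψ Ψ' F)
    (hE : ContDiff ℝ ∞ E) (hF : ContDiff ℝ ∞ F) (cs : List (ℝ × ℝ)) :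
    ∃ G : X → X, ContDiff ℝ ∞ G ∧
      IsPerturbation p (twoSplit cs Φ Ψ) (HierSplit.twoSplit cs Φ' Ψ') G := by
  induction cs with
  | nil => exact ⟨0, contDiff_const, refl p _⟩
  | cons c cs ih =>
    obtain ⟨G, hG, hp⟩ := ih
    have h1 : ContDiff ℝ ∞ (c.1 ^ (p + 1) • E + c.2 ^ (p + 1) • F) :=
      (hE.const_smul _).add (hF.const_smul _)
    have h2 := comp hΦ hΨ h h' hE.continuous (hF.of_le (mod_cast le_top)) c.1 c.2
    -- The tail of the scheme is the outer factor; its coefficients are already built in, hence the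
    -- scalings `1`.
    have h3 := comp (hΦ.comp hΨ c.1 c.2) (hΦ.twoSplit hΨ cs) h2 hp h1.continuous
      (hG.of_le (mod_cast le_top)) 1 1
    simp only [one_pow, one_smul, one_mul] at h3
    exact ⟨_, h1.add hG, h3⟩

end IsPerturbation

/-! ### Lie series, Taylor polynomials and the meaning of order. -/

theorem contDiff_lieDerivative {f g : X → X} (hf : ContDiff ℝ ∞ f) (hg : ContDiff ℝ ∞ g) :
    ContDiff ℝ ∞ (lieDerivative f g) :=
  (hg.fderiv_right (m := ∞) (by simp)).clm_apply hf

theorem contDiff_iterate_lieDerivative {f : X → X} (hf : ContDiff ℝ ∞ f) (k : ℕ) :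
    ContDiff ℝ ∞ ((lieDerivative f)^[k] id) := by
  induction k with
  | zero => exact contDiff_id
  | succ k ih => rw [Function.iterate_succ_apply']; exact contDiff_lieDerivative hf ih

theorem lieDerivative_id (f : X → X) : lieDerivative f id = f := by
  ext x; simp [lieDerivative]

/-- The Taylor polynomial of degree `n` in `h` of the `h`-flow of `x' = f x`. -/
noncomputable def flowTaylor (f : X → X) (n : ℕ) (h : ℝ) (x : X) : X :=
  ∑ k ∈ Finset.range (n + 1), (h ^ k * (k.factorial : ℝ)⁻¹) • ((lieDerivative f)^[k] id) x

theorem isNearIdentity_flowTaylor {f : X → X} (hf : ContDiff ℝ ∞ f) (n : ℕ) :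
    IsNearIdentity (flowTaylor f n) := by
  have key : ∀ h x, flowTaylor f n h x - x = ∑ k ∈ Finset.range n,
      h ^ (k + 1) • (((k + 1).factorial : ℝ)⁻¹ • ((lieDerivative f)^[k + 1] id) x) := fun h x => by
    simp [flowTaylor, Finset.sum_range_succ', smul_smul]
  have hle : ∀ (k : ℕ) {Y : Type _} [TopologicalSpace Y] (y : Y),
      (fun z : ℝ × Y => z.1 ^ (k + 1)) =O[𝓝 ((0 : ℝ), y)] (fun z : ℝ × Y => z.1) := fun k _ _ y => by
    simpa using isBigO_fst_pow_of_le (Nat.le_add_left 1 k) y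
  refine ⟨fun x₀ => ?_, fun x₀ => ?_⟩
  · simp_rw [key]
    refine IsBigO.fun_sum fun k _ => ?_
    have := (contDiff_iterate_lieDerivative hf (k + 1)).continuous
    exact (ContinuousAt.isBigO_fst_pow_smul (by fun_prop) (k + 1)).trans (hle k x₀)
  · simp_rw [key, ← Finset.sum_sub_distrib, ← smul_sub]
    refine IsBigO.fun_sum fun k _ => (hle k _).smul (IsBigO.const_smul_left ?_ _)
    have hs := ((contDiff_iterate_lieDerivative hf (k + 1)).contDiffAt (x := x₀)).hasStrictFDerivAt
      (by simp)
    exact hs.isBigO_sub.comp_tendsto (continuous_snd.tendsto ((0 : ℝ), x₀, x₀))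

theorem isPerturbation_flowTaylor_of_le {f : X → X} (hf : ContDiff ℝ ∞ f) {m n : ℕ}
    (hmn : m + 1 ≤ n) : IsPerturbation m (flowTaylor f (m + 1)) (flowTaylor f n) 0 := fun x₀ => by
  have key : ∀ h x, flowTaylor f n h x - flowTaylor f (m + 1) h x - h ^ (m + 1) • (0 : X → X) x
      = ∑ k ∈ Finset.Ico (m + 2) (n + 1),
        h ^ k • ((k.factorial : ℝ)⁻¹ • ((lieDerivative f)^[k] id) x) := fun h x => by
    rw [Finset.sum_Ico_eq_sub _ (by omega)]
    simp [flowTaylor, smul_smul]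
  simp_rw [key]
  refine IsBigO.fun_sum fun k hk => ?_
  have := (contDiff_iterate_lieDerivative hf k).continuous
  exact (ContinuousAt.isBigO_fst_pow_smul (by fun_prop) k).trans
    (isBigO_fst_pow_of_le (Finset.mem_Ico.1 hk).1 x₀)

theorem fderiv_smul_add_smul {f g : X → X} {x : X} (hf : DifferentiableAt ℝ f x)
    (hg : DifferentiableAt ℝ g x) (a b : ℝ) :
    fderiv ℝ (fun y => a • f y + b • g y) x = a • fderiv ℝ f x + b • fderiv ℝ g x :=
  ((hf.hasFDerivAt.const_smul a).add (hg.hasFDerivAt.const_smul b)).fderiv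

/-- Perturbing `h f` by `h ^ (p + 1) E` changes `D ^ (k + 2) Id` by `O(h ^ (p + 2))`. -/
theorem exists_iterate_lieDerivative_perturbed {f E : X → X} (hf : ContDiff ℝ ∞ f)
    (hE : ContDiff ℝ ∞ E) (p k : ℕ) :
    ∃ R : ℝ → X → X, ContDiff ℝ ∞ (Function.uncurry R) ∧ ∀ h x,
      ((lieDerivative fun y => h • f y + h ^ (p + 1) • E y)^[k + 2] id) x
        = h ^ (k + 2) • ((lieDerivative f)^[k + 2] id) x + h ^ (p + 2) • R h x := by
  induction k with
  | zero =>
    refine ⟨fun h x => fderiv ℝ f x (E x) + fderiv ℝ E x (f x) + h ^ p • fderiv ℝ E x (E x), ?_,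
      fun h x => ?_⟩
    · have h1 := hf.fderiv_right (m := ∞) (by simp)
      have h2 := hE.fderiv_right (m := ∞) (by simp)
      simp only [Function.uncurry_def]
      fun_prop
    · have hf' := hf.differentiable (by simp) x
      have hE' := hE.differentiable (by simp) x
      simp only [zero_add, Function.iterate_succ_apply', Function.iterate_zero, id_eq,
        lieDerivative_id]
      simp only [lieDerivative]
      rw [fderiv_smul_add_smul hf' hE']
      simp only [add_apply, smul_apply, map_add, map_smul]
      module
  | succ k ih =>
    obtain ⟨R, hR, hk⟩ := ih
    set g := (lieDerivative f)^[k + 2] id with hg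
    have hgs : ContDiff ℝ ∞ g := contDiff_iterate_lieDerivative hf _
    have h1 : ContDiff ℝ ∞ fun z : ℝ × X => fderiv ℝ (R z.1) z.2 :=
      ContDiff.fderiv (f := fun z : ℝ × X => R z.1) (m := ∞) (n := ∞)
        (hR.comp ((contDiff_fst.comp contDiff_fst).prodMk contDiff_snd)) contDiff_snd (by simp)
    have h2 := hgs.fderiv_right (m := ∞) (by simp)
    -- Deriving `h ^ (k + 2) • g` along `h ^ (p + 1) • E`, and the old remainder along the whole
    -- field, leaves these terms after `h ^ (p + 2)` is factored out.
    refine ⟨fun h x => h ^ (k + 1) • fderiv ℝ g x (E x)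
      + h • fderiv ℝ (R h) x (f x + h ^ p • E x), ?_, fun h x => ?_⟩
    · simp only [Function.uncurry_def]
      fun_prop
    · have hg' := hgs.differentiable (by simp) x
      have hR' : DifferentiableAt ℝ (R h) x :=
        (hR.comp (contDiff_prodMk_right h)).differentiable (by simp) x
      rw [show k + 1 + 2 = (k + 2) + 1 by ring, Function.iterate_succ_apply' _ (k + 2),
        Function.iterate_succ_apply' _ (k + 2), ← hg, funext (hk h)]
      simp only [lieDerivative]
      rw [fderiv_smul_add_smul hg' hR']
      simp only [add_apply, smul_apply, map_add, map_smul]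
      module

/-- `E` enters the linear term of the series as exactly `h ^ (p + 1) • E`; every later term changes
by `O(h ^ (p + 2))`. -/
theorem isPerturbation_lieExp {f E : X → X} (hf : ContDiff ℝ ∞ f) (hE : ContDiff ℝ ∞ E) (p : ℕ) :
    IsPerturbation p (flowTaylor f (p + 1))
      (fun h => lieExp (p + 1) fun y => h • f y + h ^ (p + 1) • E y) E := fun x₀ => by
  choose R hR hk using exists_iterate_lieDerivative_perturbed hf hE p
  have key : ∀ h x, lieExp (p + 1) (fun y => h • f y + h ^ (p + 1) • E y) x
      - flowTaylor f (p + 1) h x - h ^ (p + 1) • E x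
      = ∑ k ∈ Finset.range p, h ^ (p + 2) • (((k + 2).factorial : ℝ)⁻¹ • R k h x) := fun h x => by
    have hsum : ∀ u : ℕ → X, ∑ k ∈ Finset.range (p + 1 + 1), u k
        = ∑ k ∈ Finset.range p, u (k + 2) + u 1 + u 0 := fun u => by
      rw [Finset.sum_range_succ', Finset.sum_range_succ']
    simp only [lieExp, flowTaylor, hsum, hk, smul_add, Finset.sum_add_distrib, smul_smul,
      Function.iterate_one, Function.iterate_zero, lieDerivative_id, mul_comm _ (h ^ _)]
    simp
    abel
  simp_rw [key]
  refine IsBigO.fun_sum fun k _ => ?_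
  have := (hR k).continuous
  exact ContinuousAt.isBigO_fst_pow_smul (c := fun z : ℝ × X => _ • R k z.1 z.2)
    (by simp only [Function.uncurry_def] at this; fun_prop) (p + 2)

theorem hasOrder_iff {f : X → X} (hf : ContDiff ℝ ∞ f) (Φ : ℝ → X → X) (p : ℕ) :
    HasOrder f Φ p ↔ ∃ E : X → X, ContDiff ℝ ∞ E ∧ IsPerturbation p (flowTaylor f (p + 1)) Φ E := by
  refine exists_congr fun E => and_congr_right fun hE => ?_
  have h := isPerturbation_lieExp hf hE p
  constructor
  · intro H
    have H' : IsPerturbation p (fun h => lieExp (p + 1) fun y => h • f y + h ^ (p + 1) • E y) Φ 0 :=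
      fun x₀ => (H x₀).congr_left fun z => by simp
    simpa using h.trans H'
  · intro H x₀
    exact (h.symm.trans H x₀).congr_left fun z => by simp

theorem HasOrder.exists_isPerturbation {f : X → X} (hf : ContDiff ℝ ∞ f) {Φ : ℝ → X → X} {p q : ℕ}
    (hpq : p ≤ q) (h : HasOrder f Φ q) :
    ∃ E : X → X, ContDiff ℝ ∞ E ∧ IsPerturbation p (flowTaylor f (p + 1)) Φ E := by
  obtain ⟨E, hE, hq⟩ := (hasOrder_iff hf Φ q).1 h
  obtain rfl | hlt := hpq.eq_or_lt
  · exact ⟨E, hE, hq⟩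
  have h0 : IsPerturbation p (flowTaylor f (q + 1)) Φ 0 := fun x₀ => by
    refine ((hq.isBigO_sub hE.continuous x₀).trans
      (isBigO_fst_pow_of_le (by omega) x₀)).congr_left fun z => by simp
  -- For `p < q` the error of order `q + 1 ≥ p + 2` is absorbed in the remainder, so the leading
  -- error field vanishes.
  exact ⟨0 + 0, contDiff_const.add contDiff_const, (isPerturbation_flowTaylor_of_le hf (by omega)).trans h0⟩

/-! ### Taylor estimate for the exact flow. -/

/-- A curve with `σ' = t f(σ)` on `[0, 1]` that starts in `closedBall x₀ r` stays in
`closedBall x₀ (2 * r)` if `|t| C < r` for a bound `C` of `f` there. -/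
theorem mem_closedBall_of_hasDerivWithinAt_smul {f : X → X} {σ : ℝ → X} {x₀ : X} {r t C : ℝ}
    (hσ : ∀ s ∈ Icc (0 : ℝ) 1, HasDerivWithinAt σ (t • f (σ s)) (Icc 0 1) s)
    (hC : ∀ x ∈ Metric.closedBall x₀ (2 * r), ‖f x‖ ≤ C) (ht : |t| * C < r)
    (h0 : σ 0 ∈ Metric.closedBall x₀ r) {s : ℝ} (hs : s ∈ Icc (0 : ℝ) 1) :
    σ s ∈ Metric.closedBall x₀ (2 * r) := by
  have hr : 0 ≤ r := dist_nonneg.trans (Metric.mem_closedBall.1 h0)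
  have hle : ∀ u ∈ Icc (0 : ℝ) 1, r + r * u ≤ 2 * r := fun u hu => by nlinarith [hu.2]
  -- The barrier `r + r * u` has slope `r`, more than the speed `|t| * C` that the curve can have on
  -- touching it.
  have key := image_norm_le_of_norm_deriv_right_lt_deriv_boundary (f := fun u => σ u - x₀)
    (f' := fun u => t • f (σ u)) (a := 0) (b := 1) (B := fun u => r + r * u) (B' := fun _ => r)
    (fun u hu => ((hσ u hu).continuousWithinAt).sub continuousWithinAt_const)
    (fun u hu => ((hσ u (Ico_subset_Icc_self hu)).mono_of_mem_nhdsWithin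
      (Icc_mem_nhdsGE_of_mem hu)).sub_const x₀)
    (by simpa [dist_eq_norm] using h0)
    (fun u => by simpa using ((hasDerivAt_id u).const_mul r).const_add r)
    (fun u hu hu' => by
      have hmem : σ u ∈ Metric.closedBall x₀ (2 * r) := by
        rw [mem_closedBall_iff_norm, hu']
        exact hle u (Ico_subset_Icc_self hu)
      rw [norm_smul, Real.norm_eq_abs]
      exact (mul_le_mul_of_nonneg_left (hC _ hmem) (abs_nonneg t)).trans_lt ht) hs
  rw [mem_closedBall_iff_norm]
  exact key.trans (hle s hs)

/-- Flowing for the remaining time `t * (1 - u)` from `σ u` would always reach the same endpoint, so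
the derivatives of the truncated series telescope to the top term. -/
theorem hasDerivWithinAt_flowTaylor {f : X → X} (hf : ContDiff ℝ ∞ f) (n : ℕ) {σ : ℝ → X} {t s : ℝ}
    {S : Set ℝ} (hσ : HasDerivWithinAt σ (t • f (σ s)) S s) :
    HasDerivWithinAt (fun u => flowTaylor f n (t * (1 - u)) (σ u))
      (t • ((t * (1 - s)) ^ n * (n.factorial : ℝ)⁻¹) • ((lieDerivative f)^[n + 1] id) (σ s)) S s := by
  have hlin : HasDerivAt (fun u : ℝ => t * (1 - u)) (-t) s := by
    simpa using ((hasDerivAt_id s).const_sub 1).const_mul t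
  have hcomp : ∀ k, HasDerivWithinAt (fun u => ((lieDerivative f)^[k] id) (σ u))
      (t • ((lieDerivative f)^[k + 1] id) (σ s)) S s := fun k => by
    have h1 := ((contDiff_iterate_lieDerivative hf k).differentiable (by simp) (σ s)).hasFDerivAt
    have h2 := h1.comp_hasDerivWithinAt s hσ
    rw [Function.iterate_succ_apply']
    simpa [lieDerivative, Function.comp_def] using h2
  induction n with
  | zero => simpa [flowTaylor] using hcomp 0
  | succ n ih =>
    have hpow : HasDerivAt (fun u : ℝ => (t * (1 - u)) ^ (n + 1) * ((n + 1).factorial : ℝ)⁻¹)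
        (-t * ((t * (1 - s)) ^ n * (n.factorial : ℝ)⁻¹)) s := by
      refine ((hlin.fun_pow (n + 1)).mul_const ((n + 1).factorial : ℝ)⁻¹).congr_deriv ?_
      have : (n.factorial : ℝ) ≠ 0 := by positivity
      rw [Nat.factorial_succ]
      push_cast
      field_simp
    have h := ih.add (hpow.hasDerivWithinAt.smul (hcomp (n + 1)))
    have he : (fun u => flowTaylor f (n + 1) (t * (1 - u)) (σ u)) = fun u =>
        flowTaylor f n (t * (1 - u)) (σ u) + ((t * (1 - u)) ^ (n + 1) * ((n + 1).factorial : ℝ)⁻¹)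
          • ((lieDerivative f)^[n + 1] id) (σ u) := by
      ext u; rw [flowTaylor, Finset.sum_range_succ]; rfl
    rw [he]
    refine h.congr_deriv ?_
    module

theorem norm_sub_flowTaylor_le {f : X → X} (hf : ContDiff ℝ ∞ f) (n : ℕ) {σ : ℝ → X} {t C : ℝ}
    (hσ : ∀ s ∈ Icc (0 : ℝ) 1, HasDerivWithinAt σ (t • f (σ s)) (Icc 0 1) s)
    (hC : ∀ s ∈ Icc (0 : ℝ) 1, ‖((lieDerivative f)^[n + 1] id) (σ s)‖ ≤ C) :
    ‖σ 1 - flowTaylor f n t (σ 0)‖ ≤ C * |t| ^ (n + 1) := by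
  have hC0 : 0 ≤ C := (norm_nonneg _).trans (hC 0 (by simp))
  have key := norm_image_sub_le_of_norm_deriv_le_segment' (C := C * |t| ^ (n + 1))
    (fun s hs => hasDerivWithinAt_flowTaylor hf n (hσ s hs)) (fun s hs => by
      have hs' : |1 - s| ≤ 1 := by rw [abs_le]; constructor <;> linarith [hs.1, hs.2]
      have h1 : |t * (1 - s)| ^ n ≤ |t| ^ n := by
        rw [abs_mul]
        exact pow_le_pow_left₀ (by positivity) (mul_le_of_le_one_right (abs_nonneg t) hs') n
      have h2 : ((n.factorial : ℝ))⁻¹ ≤ 1 :=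
        inv_le_one_of_one_le₀ (by exact_mod_cast n.factorial_pos)
      have h3 : |t * (1 - s)| ^ n * ((n.factorial : ℝ))⁻¹ ≤ |t| ^ n := by
        simpa using mul_le_mul h1 h2 (by positivity) (by positivity)
      rw [norm_smul, norm_smul, norm_mul, norm_pow, norm_inv, Real.norm_natCast,
        Real.norm_eq_abs, Real.norm_eq_abs, pow_succ']
      calc |t| * (|t * (1 - s)| ^ n * ((n.factorial : ℝ))⁻¹ * ‖((lieDerivative f)^[n + 1] id) (σ s)‖)
          ≤ |t| * (|t| ^ n * C) := by
            gcongr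
            exact hC s (Ico_subset_Icc_self hs)
        _ = C * (|t| * |t| ^ n) := by ring) 1 (by simp)
  have h0 : flowTaylor f n (t * (1 - 1)) (σ 1) = σ 1 := by
    simp [flowTaylor, Finset.sum_range_succ']
  simpa only [h0, sub_zero, mul_one] using key

theorem exists_integralCurve_eq_exactFlow {f : X → X} {t : ℝ} {x : X}
    (h : ∃ γ : ℝ → X, γ 0 = x ∧ IsIntegralCurveOn γ (fun _ => f) (uIcc 0 t)) :
    ∃ γ : ℝ → X, γ 0 = x ∧ γ t = exactFlow f t x ∧
      IsIntegralCurveOn γ (fun _ => f) (uIcc 0 t) :=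
  ⟨h.choose, h.choose_spec.1, by rw [exactFlow, dif_pos h], h.choose_spec.2⟩

/-- Picard–Lindelöf excludes the default value of `exactFlow` for small `t`. The a priori bound
holds for whichever solution is chosen, so uniqueness is not needed. -/
theorem isPerturbation_exactFlow [CompleteSpace X] {f : X → X} (hf : ContDiff ℝ ∞ f) (p : ℕ) :
    IsPerturbation p (flowTaylor f (p + 1)) (exactFlow f) 0 := fun x₀ => by
  obtain ⟨r₁, hr₁, ε, hε, hex⟩ :=
    (hf.contDiffAt (x := x₀)).of_le (n := ∞) (m := 1) (by simp)
      |>.exists_forall_mem_closedBall_exists_eq_forall_mem_Ioo_hasDerivAt (t₀ := 0)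
  set g := (lieDerivative f)^[p + 1 + 1] id with hg
  have hgc : Continuous g := (contDiff_iterate_lieDerivative hf _).continuous
  have hev : ∀ᶠ x in 𝓝 x₀, ‖f x‖ < ‖f x₀‖ + 1 ∧ ‖g x‖ < ‖g x₀‖ + 1 :=
    ((hf.continuous.norm.tendsto x₀).eventually_lt_const (lt_add_one _)).and
      ((hgc.norm.tendsto x₀).eventually_lt_const (lt_add_one _))
  obtain ⟨r₂, hr₂, hball⟩ := Metric.nhds_basis_closedBall.eventually_iff.1 hev
  -- Solutions exist from the `r`-ball, and the `2 * r`-ball that traps them lies where `f` and `g`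
  -- are bounded.
  set r := min r₁ (r₂ / 2) with hr
  have hr0 : 0 < r := lt_min hr₁ (by positivity)
  have h2r : 2 * r ≤ r₂ := by linarith [min_le_right r₁ (r₂ / 2)]
  have hx : ∀ᶠ z : ℝ × X in 𝓝 (0, x₀), z.2 ∈ Metric.closedBall x₀ r :=
    (continuous_snd.tendsto ((0 : ℝ), x₀)).eventually (Metric.closedBall_mem_nhds x₀ hr0)
  have ht1 : ∀ᶠ z : ℝ × X in 𝓝 (0, x₀), |z.1| < ε :=
    (Continuous.tendsto' (by fun_prop) _ 0 (by simp)).eventually_lt_const hε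
  have ht2 : ∀ᶠ z : ℝ × X in 𝓝 (0, x₀), |z.1| * (‖f x₀‖ + 1) < r :=
    (Continuous.tendsto' (by fun_prop) _ 0 (by simp)).eventually_lt_const hr0
  refine IsBigO.of_bound (‖g x₀‖ + 1) ?_
  filter_upwards [hx, ht1, ht2] with ⟨t, x⟩ hx ht1 ht2
  dsimp only at hx ht1 ht2 ⊢
  obtain ⟨α, hα0, hα⟩ := hex x (Metric.closedBall_subset_closedBall (min_le_left _ _) hx)
  obtain ⟨γ, hγ0, hγt, hγ⟩ := exists_integralCurve_eq_exactFlow (f := f) (t := t) (x := x)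
    ⟨α, hα0, fun s hs => (hα s (by
      have := abs_sub_left_of_mem_uIcc hs
      rw [sub_zero, sub_zero] at this
      have := abs_lt.1 (this.trans_lt ht1)
      constructor <;> linarith [this.1, this.2])).hasDerivWithinAt⟩
  have hmaps : MapsTo (fun s : ℝ => t * s) (Icc 0 1) (uIcc 0 t) := fun s hs => by
    rcases le_total 0 t with h | h
    · rw [uIcc_of_le h]
      exact ⟨mul_nonneg h hs.1, mul_le_of_le_one_right h hs.2⟩
    · rw [uIcc_of_ge h]
      exact ⟨by nlinarith [hs.2], mul_nonpos_of_nonpos_of_nonneg h hs.1⟩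
  -- Rescaling time to `[0, 1]` treats both signs of `t` at once.
  have hσ : ∀ s ∈ Icc (0 : ℝ) 1,
      HasDerivWithinAt (fun s => γ (t * s)) (t • f (γ (t * s))) (Icc 0 1) s := fun s hs => by
    have h1 : HasDerivWithinAt (fun s : ℝ => t * s) t (Icc 0 1) s := by
      simpa using ((hasDerivAt_id s).const_mul t).hasDerivWithinAt
    exact (hγ (t * s) (hmaps hs)).scomp s h1 hmaps
  have hstay : ∀ s ∈ Icc (0 : ℝ) 1, γ (t * s) ∈ Metric.closedBall x₀ (2 * r) := fun s hs =>
    mem_closedBall_of_hasDerivWithinAt_smul (σ := fun s => γ (t * s)) hσ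
      (fun y hy => (hball (Metric.closedBall_subset_closedBall h2r hy)).1.le) ht2
      (by simpa [hγ0] using hx) hs
  have key := norm_sub_flowTaylor_le (σ := fun s => γ (t * s)) hf (p + 1) hσ
    (C := ‖g x₀‖ + 1)
    (fun s hs => (hball (Metric.closedBall_subset_closedBall h2r (hstay s hs))).2.le)
  simpa [hγ0, hγt] using key

/-! ### Induction over the splitting tree. -/

theorem HierarchicalSplittingMethod.exists_isPerturbation_step [CompleteSpace X] {N p : ℕ}
    {f : Fin N → X → X} (hf : ∀ m, ContDiff ℝ ∞ (f m)) (M : HierarchicalSplittingMethod N X)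
    (hleaf : ∀ m ∈ M.numericLeaves, ∃ q : ℕ, p ≤ q ∧ HasOrder (f m) (M.scheme m) q)
    (T : BinTree N)
    (hinner : ∀ l r : BinTree N, BinTree.node l r ∈ T.nodes → ∃ q : ℕ, p ≤ q ∧
      HasOrder (partialField f (BinTree.node l r).label) (M.innerMethod f l r) q) :
    ∃ E : X → X, ContDiff ℝ ∞ E ∧
      IsPerturbation p (flowTaylor (partialField f T.label) (p + 1)) (M.step f T) E := by
  have hpf : ∀ v, ContDiff ℝ ∞ (partialField f v) := fun v => ContDiff.sum fun m _ => hf m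
  induction T with
  | leaf m =>
    have h1 : partialField f (BinTree.leaf m).label = f m := by
      ext x; simp [partialField, BinTree.label]
    rw [h1]
    by_cases hm : m ∈ M.numericLeaves
    · obtain ⟨q, hpq, hq⟩ := hleaf m hm
      simpa [step, hm] using hq.exists_isPerturbation (hf m) hpq
    · exact ⟨0, contDiff_const, by simpa [step, hm] using isPerturbation_exactFlow (hf m) p⟩
  | node l r ihl ihr =>
    obtain ⟨El, hEl, hl⟩ := ihl fun l' r' h => hinner l' r' (Or.inr (Or.inl h))
    obtain ⟨Er, hEr, hr⟩ := ihr fun l' r' h => hinner l' r' (Or.inr (Or.inr h))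
    obtain ⟨q, hpq, hq⟩ := hinner l r (Or.inl rfl)
    obtain ⟨E, hE, h⟩ := hq.exists_isPerturbation (hpf _) hpq
    have hnl := isNearIdentity_flowTaylor (hpf l.label) (p + 1)
    have hnr := isNearIdentity_flowTaylor (hpf r.label) (p + 1)
    obtain ⟨G, hG, hstep⟩ := IsPerturbation.twoSplit hnl hnr hl hr hEl hEr
      (M.coeff (BinTree.node l r).label)
    -- Both compositions, with exact flows and with the children's steps, perturb the same
    -- composition of Taylor maps.
    obtain ⟨G', hG', hexact⟩ := IsPerturbation.twoSplit hnl hnr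
      (isPerturbation_exactFlow (hpf l.label) p) (isPerturbation_exactFlow (hpf r.label) p)
      contDiff_const contDiff_const (M.coeff (BinTree.node l r).label)
    exact ⟨_, (hE.add hG'.neg).add hG, (h.trans hexact.symm).trans hstep⟩

end HierSplit

theorem mainTheorem3 (d N p : ℕ)
    (f : Fin N → EuclideanSpace ℝ (Fin d) → EuclideanSpace ℝ (Fin d))
    (hf : ∀ m, ContDiff ℝ ∞ (f m))
    (M : HierSplit.HierarchicalSplittingMethod N (EuclideanSpace ℝ (Fin d)))
    (hinner : ∀ l r : HierSplit.BinTree N, HierSplit.BinTree.node l r ∈ M.tree.nodes →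
      ∃ q : ℕ, p ≤ q ∧
        HierSplit.HasOrder
          (HierSplit.partialField f (HierSplit.BinTree.node l r).label) (M.innerMethod f l r) q)
    (hleaf : ∀ m ∈ M.numericLeaves, ∃ q : ℕ, p ≤ q ∧ HierSplit.HasOrder (f m) (M.scheme m) q) :
    HierSplit.HasOrder (fun x => ∑ m, f m x) (M.method f) p := by
  have h := M.exists_isPerturbation_step hf hleaf M.tree hinner
  -- With the root label `Finset.univ`, the partial field is the full sum by definition.
  rw [M.root_label] at h
  exact (HierSplit.hasOrder_iff (ContDiff.sum fun m _ => hf m) _ p).2 h
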